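/- **Lemma ($MRRInd$ is an inductive invariant of MongoRaftReconfig).** **State.** Let $Server$ be a finite set. A state assigns to each server $s$: a log $log[s]$ (a finite sequence of numbers, its entries being terms; sequences are indexed from $1$, $Len$ is the length, $\mathrm{Dom}(l)=\{1,\dots,Len(l)\}$), a number $term[s]$, a role $state[s]\in\{Primary,Secondary\}$, a set $config[s]\subseteq Server$ and numbers $configVersion[s]$, $configTerm[s]$; and it has a set $committed$ of records $c$ with fields $c.entry=(index,term)$ and $c.term$. A priori numbers are integers; that they are natural numbers is part of $TypeOK$. **Notation.** $Quorums(m)=\{Q\subseteq m: 2|Q|>|m|\}$. Sets $x,y$ *overlap* if every $Q\in Quorums(x)$ meets every $Q'\in Quorums(y)$. $InLog((i,\tau),s)$: $i\in\mathrm{Dom}(log[s])$ and $log[s][i]=\tau$. $LastTerm(l)$ is the last element of $l$, and $0$ if $l$ is empty. $ImmediatelyCommitted((i,\tau),Q)$: $InLog((i,\tau),n)$ and $term[n]=\tau$ for all $n\in Q$. The configuration of $s$ is *newer* than that of $t$ if $(configTerm[s],configVersion[s])$ is lexicographically larger than $(configTerm[t],configVersion[t])$. The configuration of $s$ is *disabled*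 if every $Q\in Quorums(config[s])$ contains a server whose configuration is newer than that of $s$; otherwise $s$ is *active*. **$MRRInit$.** All logs are empty, $committed=\emptyset$, all terms and configuration terms are $0$, all servers are secondaries, all configuration versions are $1$, and all servers have the same non-empty $config$. **$MRRNext$.** There are $s,t\in Server$ and $Q\in Quorums(config[s])$ such that one of the following eight actions occurs (what is not mentioned is unchanged): 1. $ClientRequest(s)$: $s$ is a primary; $term[s]$ is appended to $log[s]$. 2. $GetEntries(s,t)$: $s$ is a secondary, $Len(log[t])>Len(log[s])$, and $log[s]$ is empty or both logs agree at index $Len(log[s])$; $log[t][Len(log[s])+1]$ is appended to $log[s]$. 3. $RollbackEntries(s,t)$: $s$ is a secondary, $log[s]$ is non-empty, $LastTerm(log[s])<LastTerm(log[t])$, and either $Len(log[s])>Len(log[t])$ or $LastTerm(log[s])\ne log[t][Len(log[s])]$; the last element of $log[s]$ is removed. 4. $CommitEntry(s,Q)$: $s$ is a primary, $log[s]$ is non-empty, its last element is $term[s]$, $e=(Len(log[s]),term[s])$ is immediately committed on $Q$ and is not the entry of an element of $committed$; the record with entry $e$ and term $term[s]$ is added to $committed$. 5. $SendConfig(s,t)$: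 $t$ is a secondary and the configuration of $s$ is newer than that of $t$; $config,configVersion,configTerm$ of $t$ become those of $s$. 6. $Reconfig(s,m)$ for some $m\subseteq Server$: $s$ is a primary and $s\in m$; some quorum of $config[s]$ consists of servers with the same configuration version and term as $s$; some quorum of $config[s]$ consists of servers with the same term as $s$; $committed=\emptyset$ or some $c\in committed$ has $c.term=term[s]$; for every $c\in committed$ with $c.term=term[s]$ there is a quorum of $config[s]$ on which $c.entry$ is immediately committed; $config[s]$ and $m$ overlap. Then $config[s]$ becomes $m$, $configVersion[s]$ increases by $1$ and $configTerm[s]$ becomes $term[s]$. 7. $BecomeLeader(s,Q)$: $s\in config[s]$, $s\in Q$, and for all $v\in Q$: $term[v]<term[s]+1$; $(LastTerm(log[s]),Len(log[s]))$ is lexicographically at least $(LastTerm(log[v]),Len(log[v]))$; the configuration of $s$ is newer than that of $v$ or has the same version and term. All members of $Q$ get the term $term[s]+1$, $s$ becomes a primary, the other members of $Q$ become secondaries, and $configTerm[s]$ becomes $term[s]+1$. 8. $UpdateTerms(s,t)$: $term[s]>term[t]$; $term[t]$ becomes $term[s]$ and $t$ becomes a secondary. **$MRRInd$** is the conjunction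 of the following twenty predicates ($s,t,p$ range over $Server$, $c$ over $committed$): 1. $TypeOK$: $log\in[Server\to Seq(\mathbb N)]$; $term,configVersion,configTerm\in[Server\to\mathbb N]$; $state\in[Server\to\{Primary,Secondary\}]$; $config\in[Server\to 2^{Server}]$; all components of elements of $committed$ are in $\mathbb N$. 2. $ElectionSafety$: two primaries with equal terms are equal. 3. $PrimaryConfigTermEqualToCurrentTerm$: $configTerm[s]=term[s]$ for every primary $s$. 4. $ConfigVersionAndTermUnique$: if $s,t$ have equal $configTerm$ and equal $configVersion$, then $config[s]=config[t]$. 5. $PrimaryInTermContainsNewestConfigOfTerm$: if $p$ is a primary and $configTerm[s]=term[p]$, then $configVersion[s]\le configVersion[p]$. 6. $ActiveConfigsOverlap$: $config[s]$ and $config[t]$ overlap for all active $s,t$. 7. $ActiveConfigsSafeAtTerms$: for every $s$, every active $t$ and every $Q\in Quorums(config[t])$ some $n\in Q$ has $term[n]\ge configTerm[s]$. 8. $LogEntryInTermImpliesConfigInTerm$: for every $i\in\mathrm{Dom}(log[s])$ there is $t$ with $configTerm[t]\ge log[s][i]$. 9. $PrimaryHasEntriesItCreated$: if $s$ is a primary,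 $k\in\mathrm{Dom}(log[t])$ and $log[t][k]=term[s]$, then $InLog((k,log[t][k]),s)$. 10. $LogMatching$: if $log[s][i]=log[t][i]$ for some $i$ in both domains, then $log[s][j]=log[t][j]$ for $1\le j\le i$. 11. $PrimaryTermAtLeastAsLargeAsLogTerms$: $log[s][i]\le term[s]$ for every primary $s$ and $i\in\mathrm{Dom}(log[s])$. 12. $TermsOfEntriesGrowMonotonically$: $log[s][i]\le log[s][j]$ for $i\le j$ in $\mathrm{Dom}(log[s])$. 13. $UniformLogEntriesInTerm$: if $i\in\mathrm{Dom}(log[s])$ is the first index of the term $log[s][i]$ in $log[s]$, then no $log[t]$ has that term at an index $k<i$. 14. $CommittedEntryIndexesAreNonZero$: the index of $c.entry$ is not $0$. 15. $CommittedTermMatchesEntry$: $c.term$ is the term of $c.entry$. 16. $LeaderCompleteness$: if $s$ is a primary and $c.term<term[s]$, then $InLog(c.entry,s)$. 17. $LogsLaterThanCommittedMustHaveCommitted$: if $log[s][i]>c.term$ for some $i\in\mathrm{Dom}(log[s])$, then $Len(log[s])\ge ind$ and $log[s][ind]=c.term$, where $ind$ is the index of $c.entry$. 18. $ActiveConfigsOverlapWithCommittedEntry$: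 for every $c$, every active $s$ and every $Q\in Quorums(config[s])$ some $n\in Q$ has $InLog(c.entry,n)$. 19. $NewerConfigsDisableCommitsInOlderTerm$: if $t$ is a primary and $term[t]<configTerm[s]$ for some $s$, then every $Q\in Quorums(config[t])$ has a member $n$ with $term[n]>term[t]$. 20. $ConfigsNonEmpty$: $config[s]\neq\emptyset$ for every $s$. **Claim.** (a) Initiation: $MRRInit\Rightarrow MRRInd$, i.e. every state satisfying $MRRInit$ satisfies $MRRInd$. (b) Consecution: $MRRInd\wedge MRRNext\Rightarrow MRRInd'$, i.e. if a state satisfies $MRRInd$ and is related by $MRRNext$ (that is, by any of the eight actions) to a second state, then the second state satisfies $MRRInd$ (that is, each of its twenty conjuncts). -/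

import Mathlib

namespace MongoRaftReconfig

/-- The two roles of a server. -/
inductive Role
  | Primary
  | Secondary

/-- An element of the set `committed`: a record with a field `entry`, the pair
`(index, term)` of a log entry, and a field `term`, the term in which it was committed. -/
@[ext]
structure Commit where
  entry : ℤ × ℤ
  term : ℤ

/-- An assignment of values to the state variables. TLA+ is untyped: numeric variables range here
over the integers, and that their values are natural numbers is asserted by `TypeOK`. -/
@[ext]
structure State (Server : Type*) where
  log : Server → List ℤ
  committed : Set Commit
  currentTerm : Server → ℤ
  state : Server → Role
  config : Server → Finset Server
  configVersion : Server → ℤ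
  configTerm : Server → ℤ

/-! ### Sequences (indexed from 1) -/

/-- The length of a sequence. -/
def Len (l : List ℤ) : ℤ := (l.length : ℤ)

/-- The domain `{1, …, Len l}` of a sequence. -/
def Dom (l : List ℤ) : Set ℤ := Set.Icc 1 (Len l)

/-- The element at index `i` of a sequence, meant for `i ∈ Dom l`. -/
def nth (l : List ℤ) (i : ℤ) : ℤ := l.getD (i - 1).toNat 0

/-- The last term of a log, `0` if the log is empty. -/
def LastTerm (l : List ℤ) : ℤ := if l = [] then 0 else nth l (Len l)

variable {Server : Type*}

/-! ### Quorums, log entries and configurations -/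

/-- The majority quorums of a set of servers. -/
def Quorums (m : Finset Server) : Set (Finset Server) := {Q | Q ⊆ m ∧ m.card < 2 * Q.card}

/-- Every quorum of `x` meets every quorum of `y`. -/
def QuorumsOverlap (x y : Finset Server) : Prop :=
  ∀ qx ∈ Quorums x, ∀ qy ∈ Quorums y, ∃ n, n ∈ qx ∧ n ∈ qy

/-- The log of `s` contains the entry `e = (index, term)`. -/
def InLog (σ : State Server) (e : ℤ × ℤ) (s : Server) : Prop :=
  e.1 ∈ Dom (σ.log s) ∧ nth (σ.log s) e.1 = e.2

/-- All members of `Q` have the entry `e` in their logs and are in the term of `e`. -/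
def ImmediatelyCommitted (σ : State Server) (e : ℤ × ℤ) (Q : Finset Server) : Prop :=
  ∀ s ∈ Q, InLog σ e s ∧ σ.currentTerm s = e.2

/-- The configuration of `i` is newer than that of `j`: terms are compared first, then versions. -/
def IsNewerConfig (σ : State Server) (i j : Server) : Prop :=
  σ.configTerm j < σ.configTerm i ∨
    (σ.configTerm i = σ.configTerm j ∧ σ.configVersion j < σ.configVersion i)

/-- The configuration of `i` is newer than that of `j`, or has the same version and term. -/
def IsNewerOrEqualConfig (σ : State Server) (i j : Server) : Prop :=
  (σ.configTerm i = σ.configTerm j ∧ σ.configVersion i = σ.configVersion j) ∨ IsNewerConfig σ i j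

/-! ### Actions

Each action relates a state `σ` to its successor `σ'`; variables that are not mentioned in the
update are unchanged. -/

variable [DecidableEq Server]

/-- Primary `s` appends an entry of its current term to its log. -/
def ClientRequest (σ σ' : State Server) (s : Server) : Prop :=
  σ.state s = Role.Primary ∧
  σ' = { σ with log := Function.update σ.log s (σ.log s ++ [σ.currentTerm s]) }

/-- Secondary `s` fetches the next log entry from `t`, provided that the log of `t` is longer and
agrees with that of `s` at the last index of the latter (no condition if the log of `s` is empty). -/
def GetEntries (σ σ' : State Server) (s t : Server) : Prop :=
  σ.state s = Role.Secondary ∧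
  Len (σ.log s) < Len (σ.log t) ∧
  (σ.log s = [] ∨ nth (σ.log t) (Len (σ.log s)) = nth (σ.log s) (Len (σ.log s))) ∧
  σ' = { σ with
    log := Function.update σ.log s (σ.log s ++ [nth (σ.log t) (Len (σ.log s) + 1)]) }

/-- The log of `s` may be rolled back against that of `t`: the last term of `s` is older, and the
log of `s` is not a prefix of the log of `t`, as witnessed by its last entry. -/
def CanRollback (σ : State Server) (s t : Server) : Prop :=
  0 < Len (σ.log s) ∧
  LastTerm (σ.log s) < LastTerm (σ.log t) ∧
  (Len (σ.log t) < Len (σ.log s) ∨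
    (Len (σ.log s) ≤ Len (σ.log t) ∧
      LastTerm (σ.log s) ≠ nth (σ.log t) (Len (σ.log s))))

/-- Secondary `s` removes the last entry of its log. -/
def RollbackEntries (σ σ' : State Server) (s t : Server) : Prop :=
  σ.state s = Role.Secondary ∧
  CanRollback σ s t ∧
  σ' = { σ with log := Function.update σ.log s (σ.log s).dropLast }

/-- Primary `s` marks the last entry of its log, which must be of its own term, as committed. -/
def CommitEntry (σ σ' : State Server) (s : Server) (Q : Finset Server) : Prop :=
  0 < Len (σ.log s) ∧
  σ.state s = Role.Primary ∧
  nth (σ.log s) (Len (σ.log s)) = σ.currentTerm s ∧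
  ImmediatelyCommitted σ (Len (σ.log s), σ.currentTerm s) Q ∧
  (¬ ∃ c ∈ σ.committed, c.entry = (Len (σ.log s), σ.currentTerm s)) ∧
  σ' = { σ with
    committed := σ.committed ∪
      {{ entry := (Len (σ.log s), σ.currentTerm s), term := σ.currentTerm s }} }

/-- Server `s` sends its configuration to secondary `t`, whose configuration is older. -/
def SendConfig (σ σ' : State Server) (s t : Server) : Prop :=
  σ.state t = Role.Secondary ∧
  IsNewerConfig σ s t ∧
  σ' = { σ with
    config := Function.update σ.config t (σ.config s)
    configVersion := Function.update σ.configVersion t (σ.configVersion s)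
    configTerm := Function.update σ.configTerm t (σ.configTerm s) }

/-- Some quorum of the configuration of `s` has installed that configuration. -/
def ConfigQuorumCheck (σ : State Server) (s : Server) : Prop :=
  ∃ Q ∈ Quorums (σ.config s), ∀ n ∈ Q,
    σ.configVersion n = σ.configVersion s ∧ σ.configTerm n = σ.configTerm s

/-- Some quorum of the configuration of `s` is in the term of `s`. -/
def TermQuorumCheck (σ : State Server) (s : Server) : Prop :=
  ∃ Q ∈ Quorums (σ.config s), ∀ n ∈ Q, σ.currentTerm n = σ.currentTerm s

/-- Either nothing has been committed, or some entry has been committed in the term of `s`; and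
every entry committed in the term of `s` is committed by a quorum of the configuration of `s`. -/
def OplogCommitment (σ : State Server) (s : Server) : Prop :=
  (σ.committed = ∅ ∨ ∃ c ∈ σ.committed, c.term = σ.currentTerm s) ∧
  ∀ c ∈ σ.committed, c.term = σ.currentTerm s →
    ∃ Q ∈ Quorums (σ.config s), ImmediatelyCommitted σ c.entry Q

/-- Primary `s` installs a new configuration with member set `m`. -/
def Reconfig (σ σ' : State Server) (s : Server) (m : Finset Server) : Prop :=
  σ.state s = Role.Primary ∧
  ConfigQuorumCheck σ s ∧
  TermQuorumCheck σ s ∧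
  OplogCommitment σ s ∧
  QuorumsOverlap (σ.config s) m ∧
  s ∈ m ∧
  σ' = { σ with
    config := Function.update σ.config s m
    configVersion := Function.update σ.configVersion s (σ.configVersion s + 1)
    configTerm := Function.update σ.configTerm s (σ.currentTerm s) }

/-- Voter `v` can vote for `s` in term `T`, as far as logs are concerned. -/
def CanVoteForOplog (σ : State Server) (v s : Server) (T : ℤ) : Prop :=
  σ.currentTerm v < T ∧
  (LastTerm (σ.log v) < LastTerm (σ.log s) ∨
    (LastTerm (σ.log s) = LastTerm (σ.log v) ∧ Len (σ.log v) ≤ Len (σ.log s)))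

/-- Voter `v` can vote for `s` in term `T`, as far as configurations are concerned. -/
def CanVoteForConfig (σ : State Server) (v s : Server) (T : ℤ) : Prop :=
  σ.currentTerm v < T ∧ IsNewerOrEqualConfig σ s v

/-- Server `s` is elected in a new term by the voters in `Q`; the voters move to the new term, and
the configuration of `s` is rewritten with the new term. -/
def BecomeLeader (σ σ' : State Server) (s : Server) (Q : Finset Server) : Prop :=
  s ∈ σ.config s ∧
  s ∈ Q ∧
  (∀ v ∈ Q, CanVoteForOplog σ v s (σ.currentTerm s + 1) ∧
    CanVoteForConfig σ v s (σ.currentTerm s + 1)) ∧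
  σ' = { σ with
    currentTerm := fun n => if n ∈ Q then σ.currentTerm s + 1 else σ.currentTerm n
    state := fun n =>
      if n = s then Role.Primary else if n ∈ Q then Role.Secondary else σ.state n
    configTerm := Function.update σ.configTerm s (σ.currentTerm s + 1) }

/-- The term of `s` is propagated to `t`, whose term is older, and which becomes a secondary. -/
def UpdateTerms (σ σ' : State Server) (s t : Server) : Prop :=
  σ.currentTerm t < σ.currentTerm s ∧
  σ' = { σ with
    currentTerm := Function.update σ.currentTerm t (σ.currentTerm s)
    state := Function.update σ.state t Role.Secondary }

/-! ### Initial states and next-state relation -/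

/-- The initial states: all servers share one non-empty configuration. -/
def MRRInit (σ : State Server) : Prop :=
  (σ.log = fun _ => []) ∧
  σ.committed = ∅ ∧
  (σ.currentTerm = fun _ => 0) ∧
  (σ.state = fun _ => Role.Secondary) ∧
  (∃ m : Finset Server, m.Nonempty ∧ σ.config = fun _ => m) ∧
  (σ.configVersion = fun _ => 1) ∧
  (σ.configTerm = fun _ => 0)

/-- The next-state relation, the disjunction of the eight actions. -/
def MRRNext (σ σ' : State Server) : Prop :=
  ∃ s t : Server, ∃ Q ∈ Quorums (σ.config s),
    ClientRequest σ σ' s ∨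
    GetEntries σ σ' s t ∨
    RollbackEntries σ σ' s t ∨
    CommitEntry σ σ' s Q ∨
    SendConfig σ σ' s t ∨
    (∃ m : Finset Server, Reconfig σ σ' s m) ∨
    BecomeLeader σ σ' s Q ∨
    UpdateTerms σ σ' s t

/-! ### The conjuncts of the inductive invariant -/

/-- All numeric values are natural numbers. (That variables are functions on the set of servers,
with values sequences, roles or sets of servers where required, is part of `State`.) -/
def TypeOK (σ : State Server) : Prop :=
  (∀ s, ∀ x ∈ σ.log s, 0 ≤ x) ∧
  (∀ c ∈ σ.committed, 0 ≤ c.entry.1 ∧ 0 ≤ c.entry.2 ∧ 0 ≤ c.term) ∧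
  (∀ s, 0 ≤ σ.currentTerm s) ∧
  (∀ s, σ.state s = Role.Primary ∨ σ.state s = Role.Secondary) ∧
  (∀ s, 0 ≤ σ.configVersion s) ∧
  (∀ s, 0 ≤ σ.configTerm s)

/-- There is at most one primary per term. -/
def ElectionSafety (σ : State Server) : Prop :=
  ∀ s t, σ.state s = Role.Primary → σ.state t = Role.Primary →
    σ.currentTerm s = σ.currentTerm t → s = t

def PrimaryConfigTermEqualToCurrentTerm (σ : State Server) : Prop :=
  ∀ s, σ.state s = Role.Primary → σ.configTerm s = σ.currentTerm s

/-- The version and the term of a configuration determine its member set. -/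
def ConfigVersionAndTermUnique (σ : State Server) : Prop :=
  ∀ s t, σ.configTerm s = σ.configTerm t → σ.configVersion s = σ.configVersion t →
    σ.config s = σ.config t

/-- A primary has the newest configuration of its term. -/
def PrimaryInTermContainsNewestConfigOfTerm (σ : State Server) : Prop :=
  ∀ p s, σ.state p = Role.Primary → σ.configTerm s = σ.currentTerm p →
    σ.configVersion s ≤ σ.configVersion p

/-- Every quorum of the configuration of `s` contains a server with a newer configuration. -/
def ConfigDisabled (σ : State Server) (s : Server) : Prop :=
  ∀ Q ∈ Quorums (σ.config s), ∃ n ∈ Q, IsNewerConfig σ n s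

/-- The servers whose configurations are active, that is, not disabled. -/
def ActiveConfigSet (σ : State Server) : Set Server := {s | ¬ ConfigDisabled σ s}

def ActiveConfigsOverlap (σ : State Server) : Prop :=
  ∀ s ∈ ActiveConfigSet σ, ∀ t ∈ ActiveConfigSet σ, QuorumsOverlap (σ.config s) (σ.config t)

/-- Every quorum of an active configuration contains a server whose term is at least the term of
any given configuration. -/
def ActiveConfigsSafeAtTerms (σ : State Server) : Prop :=
  ∀ s, ∀ t ∈ ActiveConfigSet σ, ∀ Q ∈ Quorums (σ.config t), ∃ n ∈ Q,
    σ.configTerm s ≤ σ.currentTerm n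

/-- A log entry in some term implies that there is a configuration in this or a later term. -/
def LogEntryInTermImpliesConfigInTerm (σ : State Server) : Prop :=
  ∀ s, ∀ i ∈ Dom (σ.log s), ∃ t, nth (σ.log s) i ≤ σ.configTerm t

/-- A primary has every entry of its term that occurs in any log. -/
def PrimaryHasEntriesItCreated (σ : State Server) : Prop :=
  ∀ s t, σ.state s = Role.Primary →
    ¬ ∃ k ∈ Dom (σ.log t), nth (σ.log t) k = σ.currentTerm s ∧
      ¬ InLog σ (k, nth (σ.log t) k) s

/-- Logs with the same entry at an index agree up to that index. -/
def LogMatching (σ : State Server) : Prop :=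
  ∀ s t, ∀ i ∈ Dom (σ.log s) ∩ Dom (σ.log t), nth (σ.log s) i = nth (σ.log t) i →
    ∀ j ∈ Set.Icc 1 i, nth (σ.log s) j = nth (σ.log t) j

def PrimaryTermAtLeastAsLargeAsLogTerms (σ : State Server) : Prop :=
  ∀ s, σ.state s = Role.Primary → ∀ i ∈ Dom (σ.log s), nth (σ.log s) i ≤ σ.currentTerm s

def TermsOfEntriesGrowMonotonically (σ : State Server) : Prop :=
  ∀ s, ∀ i ∈ Dom (σ.log s), ∀ j ∈ Dom (σ.log s), i ≤ j → nth (σ.log s) i ≤ nth (σ.log s) j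

/-- If the first entry of some term in a log is at index `i`, then no log has an entry of that term
at an index smaller than `i`. -/
def UniformLogEntriesInTerm (σ : State Server) : Prop :=
  ∀ s t, ∀ i ∈ Dom (σ.log s),
    (∀ j ∈ Dom (σ.log s), j < i → nth (σ.log s) j ≠ nth (σ.log s) i) →
    ¬ ∃ k ∈ Dom (σ.log t), nth (σ.log t) k = nth (σ.log s) i ∧ k < i

def CommittedEntryIndexesAreNonZero (σ : State Server) : Prop :=
  ∀ c ∈ σ.committed, c.entry.1 ≠ 0

def CommittedTermMatchesEntry (σ : State Server) : Prop :=
  ∀ c ∈ σ.committed, c.term = c.entry.2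

/-- Entries committed in a term are in the log of any primary of a later term. -/
def LeaderCompleteness (σ : State Server) : Prop :=
  ∀ s, ∀ c ∈ σ.committed, σ.state s = Role.Primary → c.term < σ.currentTerm s → InLog σ c.entry s

/-- A log with an entry of a term later than that of a committed entry has the committed entry. -/
def LogsLaterThanCommittedMustHaveCommitted (σ : State Server) : Prop :=
  ∀ s, ∀ c ∈ σ.committed, (∃ i ∈ Dom (σ.log s), c.term < nth (σ.log s) i) →
    c.entry.1 ≤ Len (σ.log s) ∧ nth (σ.log s) c.entry.1 = c.term

/-- Every quorum of an active configuration has a member with a given committed entry. -/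
def ActiveConfigsOverlapWithCommittedEntry (σ : State Server) : Prop :=
  ∀ c ∈ σ.committed, ∀ s ∈ ActiveConfigSet σ, ∀ Q ∈ Quorums (σ.config s), ∃ n ∈ Q,
    InLog σ c.entry n

/-- If there is a configuration in a term later than that of a primary, then every quorum of the
configuration of the primary has a member in a term later than that of the primary. -/
def NewerConfigsDisableCommitsInOlderTerm (σ : State Server) : Prop :=
  ∀ s t, σ.state t = Role.Primary → σ.currentTerm t < σ.configTerm s →
    ∀ Q ∈ Quorums (σ.config t), ∃ n ∈ Q, σ.currentTerm t < σ.currentTerm n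

def ConfigsNonEmpty (σ : State Server) : Prop :=
  ∀ s, σ.config s ≠ ∅

/-- The inductive invariant, a conjunction of twenty state predicates. -/
def MRRInd (σ : State Server) : Prop :=
  TypeOK σ ∧
  ElectionSafety σ ∧
  PrimaryConfigTermEqualToCurrentTerm σ ∧
  ConfigVersionAndTermUnique σ ∧
  PrimaryInTermContainsNewestConfigOfTerm σ ∧
  ActiveConfigsOverlap σ ∧
  ActiveConfigsSafeAtTerms σ ∧
  LogEntryInTermImpliesConfigInTerm σ ∧
  PrimaryHasEntriesItCreated σ ∧
  LogMatching σ ∧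
  PrimaryTermAtLeastAsLargeAsLogTerms σ ∧
  TermsOfEntriesGrowMonotonically σ ∧
  UniformLogEntriesInTerm σ ∧
  CommittedEntryIndexesAreNonZero σ ∧
  CommittedTermMatchesEntry σ ∧
  LeaderCompleteness σ ∧
  LogsLaterThanCommittedMustHaveCommitted σ ∧
  ActiveConfigsOverlapWithCommittedEntry σ ∧
  NewerConfigsDisableCommitsInOlderTerm σ ∧
  ConfigsNonEmpty σ

end MongoRaftReconfig

/-!
The invariant is strong enough for each action to be treated on its own, from the state before it.
Three arguments carry the proof.

*Logs.* A log entry is created only by the primary of its term, which holds all entries of that term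
already, so that a new entry clashes with no other (`Inv.clientRequest`). Replicating an entry
replaces a log by a prefix of another one, by log matching, and a rollback replaces it by a prefix of
itself; the log predicates pass to prefixes (`Inv.of_prefix`). A rollback removes no committed entry,
since the later log it is compared with would contain that entry.

*Terms.* If a quorum of the configuration of a primary is still in its term, then no configuration,
and thus no log entry and no other primary, has a later term (`Inv.configTerm_le_of_quorum`). This
makes a commit safe. It also shows that a primary about to reconfigure has the newest configuration;
as a quorum has installed it, every configuration that is active afterwards, other than the new one,
is a copy of it, and the new configuration overlaps these. The commitment check puts every committed
entry on a quorum of the old configuration, which the quorums of the new one meet.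

*Elections.* The configuration of the winner is at least as new as those of its voters, so it is
active. Hence its quorums see the terms of all configurations, the new term is fresh, and the voters
meet all quorums of active configurations. Some voter has any given committed entry, and the log
comparison transfers the entry to the winner (`Inv.inLog_of_upToDate`).

Throughout, a configuration active after an action has the members of one active before it, except
for the one created by a reconfiguration (`active_of_active`).
-/

namespace MongoRaftReconfig

/-! ### Sequences -/

theorem mem_Dom {l : List ℤ} {i : ℤ} : i ∈ Dom l ↔ 1 ≤ i ∧ i ≤ Len l := Iff.rfl

theorem Len_append_singleton (l : List ℤ) (a : ℤ) : Len (l ++ [a]) = Len l + 1 := by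
  simp [Len]

theorem nth_eq_getElem {l : List ℤ} {i : ℤ} (hi : i ∈ Dom l) :
    ∃ h : (i - 1).toNat < l.length, nth l i = l[(i - 1).toNat] := by
  have h : (i - 1).toNat < l.length := by
    have := mem_Dom.1 hi
    simp only [Len] at this
    omega
  exact ⟨h, List.getD_eq_getElem _ _ h⟩

theorem nth_mem {l : List ℤ} {i : ℤ} (hi : i ∈ Dom l) : nth l i ∈ l := by
  obtain ⟨h, e⟩ := nth_eq_getElem hi
  exact e ▸ List.getElem_mem h

theorem mem_Dom_of_prefix {l l' : List ℤ} (h : l <+: l') {i : ℤ} (hi : i ∈ Dom l) :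
    i ∈ Dom l' := by
  have := h.length_le
  simp only [mem_Dom, Len] at *
  omega

theorem nth_of_prefix {l l' : List ℤ} (h : l <+: l') {i : ℤ} (hi : i ∈ Dom l) :
    nth l' i = nth l i := by
  obtain ⟨h₁, e₁⟩ := nth_eq_getElem hi
  obtain ⟨h₂, e₂⟩ := nth_eq_getElem (mem_Dom_of_prefix h hi)
  rw [e₁, e₂, h.getElem h₁]

theorem nth_append_singleton (l : List ℤ) (a : ℤ) : nth (l ++ [a]) (Len l + 1) = a := by
  simp [nth, Len]

/-- An index of `l ++ [a]` is an index of `l` or that of the new element. -/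
theorem mem_Dom_append_cases {l : List ℤ} {a i : ℤ} (hi : i ∈ Dom (l ++ [a])) :
    (i ∈ Dom l ∧ nth (l ++ [a]) i = nth l i) ∨ (i = Len l + 1 ∧ nth (l ++ [a]) i = a) := by
  by_cases h : i = Len l + 1
  · exact .inr ⟨h, h ▸ nth_append_singleton l a⟩
  · have hl : i ∈ Dom l := by
      rw [mem_Dom, Len_append_singleton] at hi
      rw [mem_Dom]
      omega
    exact .inl ⟨hl, nth_of_prefix (List.prefix_append l [a]) hl⟩

/-- If `l` is shorter than `l'` and agrees with it at all of its indices, then so does the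
extension of `l` by the next element of `l'`. -/
theorem append_nth_prefix {l l' : List ℤ} (hlen : Len l < Len l')
    (h : ∀ i ∈ Dom l, nth l i = nth l' i) : l ++ [nth l' (Len l + 1)] <+: l' := by
  have hlen' : l.length < l'.length := by simpa [Len] using hlen
  have hl : l = l'.take l.length := by
    refine List.ext_getElem (by simp; omega) fun n h₁ h₂ => ?_
    have := h (n + 1) (by simp only [mem_Dom, Len]; omega)
    simpa [nth, h₁, h₁.trans hlen'] using this
  have hn : nth l' (Len l + 1) = l'[l.length] := by simp [nth, Len, hlen']
  have : l ++ [nth l' (Len l + 1)] = l'.take (l.length + 1) := by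
    rw [List.take_succ_eq_append_getElem hlen', ← hl, hn]
  exact this ▸ List.take_prefix _ _

theorem Len_pos_iff {l : List ℤ} : 0 < Len l ↔ l ≠ [] := by
  simp [Len, List.length_pos_iff]

theorem LastTerm_of_pos {l : List ℤ} (h : 0 < Len l) : LastTerm l = nth l (Len l) :=
  if_neg (Len_pos_iff.1 h)

variable {Server : Type*}

/-! ### Quorums -/

theorem quorum_nonempty {m Q : Finset Server} (hQ : Q ∈ Quorums m) : Q.Nonempty := by
  have := hQ.2
  exact Finset.card_pos.1 (by omega)

theorem quorumsOverlap_self [DecidableEq Server] (m : Finset Server) : QuorumsOverlap m m := by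
  intro q hq q' hq'
  by_contra! hne
  have hd : Disjoint q q' := Finset.disjoint_left.2 hne
  have h₁ := Finset.card_union_of_disjoint hd
  have h₂ := Finset.card_le_card (Finset.union_subset hq.1 hq'.1)
  have h₃ := hq.2
  have h₄ := hq'.2
  omega

theorem QuorumsOverlap.symm {x y : Finset Server} (h : QuorumsOverlap x y) :
    QuorumsOverlap y x := fun q hq q' hq' =>
  let ⟨n, h₁, h₂⟩ := h q' hq' q hq
  ⟨n, h₂, h₁⟩

/-! ### Consequences of the invariant -/

/-- The invariant `MRRInd` as a structure, which gives names to its twenty conjuncts. -/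
structure Inv (σ : State Server) : Prop where
  typeOK : TypeOK σ
  electionSafety : ElectionSafety σ
  primaryConfigTerm : PrimaryConfigTermEqualToCurrentTerm σ
  configUnique : ConfigVersionAndTermUnique σ
  primaryNewest : PrimaryInTermContainsNewestConfigOfTerm σ
  activeOverlap : ActiveConfigsOverlap σ
  activeSafe : ActiveConfigsSafeAtTerms σ
  entryConfig : LogEntryInTermImpliesConfigInTerm σ
  primaryHas : PrimaryHasEntriesItCreated σ
  logMatching : LogMatching σ
  primaryTerm : PrimaryTermAtLeastAsLargeAsLogTerms σ
  monotone : TermsOfEntriesGrowMonotonically σ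
  uniform : UniformLogEntriesInTerm σ
  indexNonZero : CommittedEntryIndexesAreNonZero σ
  termMatches : CommittedTermMatchesEntry σ
  leaderComplete : LeaderCompleteness σ
  logsLater : LogsLaterThanCommittedMustHaveCommitted σ
  activeCommitted : ActiveConfigsOverlapWithCommittedEntry σ
  newerDisable : NewerConfigsDisableCommitsInOlderTerm σ
  nonEmpty : ConfigsNonEmpty σ

theorem mrrInd_iff_inv {σ : State Server} : MRRInd σ ↔ Inv σ :=
  ⟨fun ⟨h₁, h₂, h₃, h₄, h₅, h₆, h₇, h₈, h₉, h₁₀, h₁₁, h₁₂, h₁₃, h₁₄, h₁₅, h₁₆, h₁₇, h₁₈, h₁₉,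
      h₂₀⟩ =>
    ⟨h₁, h₂, h₃, h₄, h₅, h₆, h₇, h₈, h₉, h₁₀, h₁₁, h₁₂, h₁₃, h₁₄, h₁₅, h₁₆, h₁₇, h₁₈, h₁₉, h₂₀⟩,
  fun ⟨h₁, h₂, h₃, h₄, h₅, h₆, h₇, h₈, h₉, h₁₀, h₁₁, h₁₂, h₁₃, h₁₄, h₁₅, h₁₆, h₁₇, h₁₈, h₁₉,
      h₂₀⟩ =>
    ⟨h₁, h₂, h₃, h₄, h₅, h₆, h₇, h₈, h₉, h₁₀, h₁₁, h₁₂, h₁₃, h₁₄, h₁₅, h₁₆, h₁₇, h₁₈, h₁₉, h₂₀⟩⟩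

theorem mem_activeConfigSet {σ : State Server} {s : Server} :
    s ∈ ActiveConfigSet σ ↔ ∃ Q ∈ Quorums (σ.config s), ∀ n ∈ Q, ¬ IsNewerConfig σ n s := by
  simp only [ActiveConfigSet, ConfigDisabled, Set.mem_ofPred_eq]
  push Not
  rfl

/-- If every configuration newer than that of `y` is newer, in the successor state, than that of
`x`, which has the same members, then `y` is active if `x` is active in the successor state. -/
theorem active_of_active {σ σ' : State Server} {x y : Server} (hc : σ'.config x = σ.config y)
    (hn : ∀ n, IsNewerConfig σ n y → IsNewerConfig σ' n x) (hx : x ∈ ActiveConfigSet σ') :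
    y ∈ ActiveConfigSet σ := by
  obtain ⟨Q, hQ, h⟩ := mem_activeConfigSet.1 hx
  exact mem_activeConfigSet.2 ⟨Q, hc ▸ hQ, fun n hnQ hny => h n hnQ (hn n hny)⟩

namespace Inv

variable {σ : State Server}

theorem one_le_index (h : Inv σ) {c : Commit} (hc : c ∈ σ.committed) : 1 ≤ c.entry.1 := by
  have h₁ := h.indexNonZero c hc
  have h₂ := (h.typeOK.2.1 c hc).1
  omega

/-- A committed entry precedes, in every log, all entries of later terms. -/
theorem inLog_of_later (h : Inv σ) {c : Commit} (hc : c ∈ σ.committed) {s : Server} {i : ℤ}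
    (hi : i ∈ Dom (σ.log s)) (hlt : c.term < nth (σ.log s) i) :
    InLog σ c.entry s ∧ c.entry.1 < i := by
  obtain ⟨h₁, h₂⟩ := h.logsLater s c hc ⟨i, hi, hlt⟩
  have hd : c.entry.1 ∈ Dom (σ.log s) := ⟨h.one_le_index hc, h₁⟩
  refine ⟨⟨hd, h₂.trans (h.termMatches c hc)⟩, ?_⟩
  by_contra! hle
  have := h.monotone s i hi _ hd hle
  omega

/-- If a quorum of the configuration of a primary has not moved to a later term, then no
configuration has a later term. -/
theorem configTerm_le_of_quorum (h : Inv σ) {p : Server} (hp : σ.state p = Role.Primary)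
    {Q : Finset Server} (hQ : Q ∈ Quorums (σ.config p))
    (hT : ∀ n ∈ Q, σ.currentTerm n = σ.currentTerm p) (x : Server) :
    σ.configTerm x ≤ σ.currentTerm p := by
  by_contra! hlt
  obtain ⟨n, hn, hgt⟩ := h.newerDisable x p hp hlt Q hQ
  have := hT n hn
  omega

/-- A configuration newer than that of a primary has a later term, since a primary has the newest
configuration of its own term. -/
theorem term_lt_of_newer (h : Inv σ) {p x : Server} (hp : σ.state p = Role.Primary)
    (hx : IsNewerConfig σ x p) : σ.currentTerm p < σ.configTerm x := by
  have h₁ := h.primaryConfigTerm p hp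
  have h₂ := h.primaryNewest p x hp
  rcases hx with hx | ⟨hx, hv⟩
  · omega
  · have := h₂ (by omega)
    omega

theorem exists_configTerm_ge (h : Inv σ) {s : Server} {e : ℤ × ℤ} (he : InLog σ e s) :
    ∃ t, e.2 ≤ σ.configTerm t :=
  he.2 ▸ h.entryConfig s e.1 he.1

/-- The log comparison of an election: a log that is at least as up-to-date as one with a given
committed entry has this entry. -/
theorem inLog_of_upToDate (h : Inv σ) {c : Commit} (hc : c ∈ σ.committed) {s v : Server}
    (hv : InLog σ c.entry v)
    (hlog : LastTerm (σ.log v) < LastTerm (σ.log s) ∨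
      (LastTerm (σ.log s) = LastTerm (σ.log v) ∧ Len (σ.log v) ≤ Len (σ.log s))) :
    InLog σ c.entry s := by
  obtain ⟨hd, hval⟩ := hv
  have hct := h.termMatches c hc
  have hd' := mem_Dom.1 hd
  have hvpos : 0 < Len (σ.log v) := by omega
  have hvlast : Len (σ.log v) ∈ Dom (σ.log v) := ⟨by omega, le_rfl⟩
  have hvge : c.term ≤ LastTerm (σ.log v) := by
    have := h.monotone v _ hd _ hvlast hd'.2
    rw [LastTerm_of_pos hvpos]
    omega
  have hspos : 0 < Len (σ.log s) := by
    rcases hlog with hlt | ⟨-, hle⟩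
    · -- The last term of an empty log is `0`, which exceeds no term.
      refine Len_pos_iff.2 fun hnil => ?_
      have h₀ : LastTerm (σ.log s) = 0 := if_pos hnil
      have := (h.typeOK.2.1 c hc).2.2
      omega
    · omega
  have hslast : Len (σ.log s) ∈ Dom (σ.log s) := ⟨by omega, le_rfl⟩
  have hsl := LastTerm_of_pos hspos
  by_cases hgt : c.term < nth (σ.log s) (Len (σ.log s))
  · exact (h.inLog_of_later hc hslast hgt).1
  have heq : nth (σ.log s) (Len (σ.log s)) = c.term := by omega
  have hle : Len (σ.log v) ≤ Len (σ.log s) := by omega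
  have hds : c.entry.1 ∈ Dom (σ.log s) := ⟨hd'.1, by omega⟩
  refine ⟨hds, ?_⟩
  by_contra hne
  have hmono := h.monotone s _ hds _ hslast hds.2
  -- Otherwise the term of `c` starts in the log of `s` after the index of `c`, against uniformity.
  classical
  have hex : ∃ k : ℕ, (k : ℤ) ∈ Dom (σ.log s) ∧ nth (σ.log s) k = c.term :=
    ⟨(Len (σ.log s)).toNat, by rw [Int.toNat_of_nonneg hspos.le]; exact ⟨hslast, heq⟩⟩
  obtain ⟨hk, hkc⟩ := Nat.find_spec hex
  refine h.uniform s v _ hk (fun j hj hjk hjc => ?_) ⟨c.entry.1, hd, by omega, ?_⟩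
  · have hj₀ : (j.toNat : ℤ) = j := Int.toNat_of_nonneg (by have := hj.1; omega)
    exact Nat.find_min hex (m := j.toNat) (by omega) (by rw [hj₀]; exact ⟨hj, by omega⟩)
  · by_contra! hge
    have := h.monotone s _ hk _ hds hge
    omega

/-! ### Actions that change logs -/

variable [DecidableEq Server]

theorem clientRequest (h : Inv σ) {σ' : State Server} {s : Server} (ha : ClientRequest σ σ' s) :
    Inv σ' := by
  obtain ⟨hs, rfl⟩ := ha
  set L := Function.update σ.log s (σ.log s ++ [σ.currentTerm s]) with hL
  have hpre : ∀ x, σ.log x <+: L x := by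
    intro x
    by_cases hx : x = s
    · subst hx; simp [hL]
    · simp [hL, hx]
  have hin : ∀ {e x}, InLog σ e x → e.1 ∈ Dom (L x) ∧ nth (L x) e.1 = e.2 := fun he =>
    ⟨mem_Dom_of_prefix (hpre _) he.1, (nth_of_prefix (hpre _) he.1).trans he.2⟩
  have hcases : ∀ x, ∀ i ∈ Dom (L x), (i ∈ Dom (σ.log x) ∧ nth (L x) i = nth (σ.log x) i) ∨
      (x = s ∧ i = Len (σ.log s) + 1 ∧ nth (L x) i = σ.currentTerm s) := by
    intro x i hi
    by_cases hx : x = s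
    · subst hx
      rw [hL, Function.update_self] at hi ⊢
      exact (mem_Dom_append_cases hi).imp id fun h => ⟨rfl, h⟩
    · rw [hL, Function.update_of_ne hx] at hi ⊢
      exact .inl ⟨hi, rfl⟩
  have hold : ∀ x, ∀ i ∈ Dom (σ.log x), i ∈ Dom (L x) ∧ nth (L x) i = nth (σ.log x) i :=
    fun x i hi => ⟨mem_Dom_of_prefix (hpre x) hi, nth_of_prefix (hpre x) hi⟩
  have hnew : Len (σ.log s) + 1 ∈ Dom (L s) ∧ nth (L s) (Len (σ.log s) + 1) = σ.currentTerm s := by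
    simp only [hL, Function.update_self, nth_append_singleton, and_true, mem_Dom,
      Len_append_singleton]
    have : 0 ≤ Len (σ.log s) := by simp [Len]
    omega
  -- The log of the primary `s` holds all entries of its term, at indices up to its length.
  have hhas : ∀ x, ∀ k ∈ Dom (σ.log x), nth (σ.log x) k = σ.currentTerm s →
      k ∈ Dom (σ.log s) ∧ nth (σ.log s) k = σ.currentTerm s := by
    intro x k hk hkt
    by_contra hno
    exact h.primaryHas s x hs ⟨k, hk, hkt, fun hin => hno ⟨hin.1, hin.2.trans hkt⟩⟩
  exact
    { h with
      typeOK := by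
        refine ⟨fun x y hy => ?_, h.typeOK.2⟩
        change y ∈ L x at hy
        by_cases hx : x = s
        · subst hx
          rw [hL, Function.update_self, List.mem_append, List.mem_singleton] at hy
          rcases hy with hy | rfl
          · exact h.typeOK.1 _ _ hy
          · exact h.typeOK.2.2.1 _
        · rw [hL, Function.update_of_ne hx] at hy
          exact h.typeOK.1 _ _ hy
      entryConfig := by
        intro x i hi
        rcases hcases x i hi with ⟨hi', e⟩ | ⟨-, -, e⟩
        · obtain ⟨t, ht⟩ := h.entryConfig x i hi'
          exact ⟨t, e.trans_le ht⟩
        · exact ⟨s, (e.trans (h.primaryConfigTerm s hs).symm).le⟩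
      primaryHas := by
        rintro p x hp ⟨k, hk, hkp, hno⟩
        change nth (L x) k = σ.currentTerm p at hkp
        rcases hcases x k hk with ⟨hk', e⟩ | ⟨rfl, rfl, e⟩
        · refine h.primaryHas p x hp ⟨k, hk', e ▸ hkp, fun hin' => hno ?_⟩
          have := hin hin'
          exact ⟨this.1, this.2.trans e.symm⟩
        · have : p = x := h.electionSafety p x hp hs (by omega)
          subst this
          exact hno ⟨hk, rfl⟩
      logMatching := by
        rintro x y i ⟨hix, hiy⟩ he j hj
        change nth (L x) i = nth (L y) i at he
        change nth (L x) j = nth (L y) j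
        rcases hcases x i hix with ⟨hx, ex⟩ | ⟨rfl, rfl, ex⟩ <;>
          rcases hcases y _ hiy with ⟨hy, ey⟩ | ⟨hys, hyi, ey⟩
        · have hjx : j ∈ Dom (σ.log x) := ⟨hj.1, hj.2.trans hx.2⟩
          have hjy : j ∈ Dom (σ.log y) := ⟨hj.1, hj.2.trans hy.2⟩
          rw [(hold x j hjx).2, (hold y j hjy).2]
          exact h.logMatching x y i ⟨hx, hy⟩ (by rw [← ex, ← ey, he]) j hj
        · have := (hhas x i hx (by omega)).1.2
          omega
        · have := (hhas y _ hy (by omega)).1.2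
          omega
        · rw [hys]
      primaryTerm := by
        intro p hp i hi
        rcases hcases p i hi with ⟨hi', e⟩ | ⟨rfl, -, e⟩
        · exact e.trans_le (h.primaryTerm p hp i hi')
        · exact e.le
      monotone := by
        intro x i hi j hj hij
        change nth (L x) i ≤ nth (L x) j
        rcases hcases x i hi with ⟨hi', ei⟩ | ⟨rfl, rfl, ei⟩ <;>
          rcases hcases _ j hj with ⟨hj', ej⟩ | ⟨hxs, hji, ej⟩
        · rw [ei, ej]
          exact h.monotone x i hi' j hj' hij
        · subst hxs
          rw [ei, ej]
          exact h.primaryTerm x hs i hi'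
        · have := hj'.2
          omega
        · omega
      uniform := by
        rintro x y i hi hfirst ⟨k, hk, hki, hlt⟩
        change ∀ j ∈ Dom (L x), j < i → nth (L x) j ≠ nth (L x) i at hfirst
        change nth (L y) k = nth (L x) i at hki
        rcases hcases x i hi with ⟨hi', ei⟩ | ⟨rfl, rfl, ei⟩ <;>
          rcases hcases y k hk with ⟨hk', ek⟩ | ⟨hys, hyk, ek⟩
        · refine h.uniform x y i hi' (fun j hj hji => ?_) ⟨k, hk', by rw [← ei, ← ek, hki], hlt⟩
          have := hfirst j (hold x j hj).1 hji
          rwa [(hold x j hj).2, ei] at this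
        · have := (hhas x i hi' (by omega)).1.2
          omega
        · obtain ⟨h₁, h₂⟩ := hhas y k hk' (by omega)
          exact hfirst k (hold x k h₁).1 hlt (by rw [(hold x k h₁).2, h₂, ei])
        · omega
      leaderComplete := fun p c hc hp hlt => hin (h.leaderComplete p c hc hp hlt)
      logsLater := by
        rintro x c hc ⟨i, hi, hlt⟩
        change c.term < nth (L x) i at hlt
        have hix : InLog σ c.entry x := by
          rcases hcases x i hi with ⟨hi', e⟩ | ⟨rfl, -, e⟩
          · exact (h.inLog_of_later hc hi' (e ▸ hlt)).1
          · exact h.leaderComplete x c hc hs (e ▸ hlt)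
        exact ⟨(hin hix).1.2, (hin hix).2.trans (h.termMatches c hc).symm⟩
      activeCommitted := fun c hc x hx Q hQ =>
        let ⟨n, hn, hin'⟩ := h.activeCommitted c hc x hx Q hQ
        ⟨n, hn, hin hin'⟩ }

omit [DecidableEq Server] in
/-- Replacing logs by prefixes of logs of the same state preserves the invariant, provided that the
logs of primaries do not change and that committed entries stay on quorums: all other log predicates
concern entries that occur in logs, and their predecessors. -/
theorem of_prefix (h : Inv σ) {L : Server → List ℤ} (hpre : ∀ x, ∃ y, L x <+: σ.log y)
    (hprim : ∀ x, σ.state x = Role.Primary → L x = σ.log x)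
    (hcom : ActiveConfigsOverlapWithCommittedEntry { σ with log := L }) :
    Inv { σ with log := L } := by
  choose f hf using hpre
  have hdom : ∀ {x i}, i ∈ Dom (L x) → i ∈ Dom (σ.log (f x)) :=
    fun hi => mem_Dom_of_prefix (hf _) hi
  have hnth : ∀ {x i}, i ∈ Dom (L x) → nth (L x) i = nth (σ.log (f x)) i :=
    fun hi => (nth_of_prefix (hf _) hi).symm
  have hlow : ∀ {x i j}, i ∈ Dom (L x) → 1 ≤ j → j ≤ i → j ∈ Dom (L x) :=
    fun hi h₁ h₂ => ⟨h₁, h₂.trans hi.2⟩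
  have hin : ∀ {e x}, σ.state x = Role.Primary → InLog σ e x → InLog { σ with log := L } e x :=
    fun hp he => by simpa only [InLog, hprim _ hp] using he
  exact
    { h with
      typeOK := ⟨fun x y hy => h.typeOK.1 (f x) y ((hf x).subset hy), h.typeOK.2⟩
      entryConfig := fun x i hi =>
        let ⟨t, ht⟩ := h.entryConfig (f x) i (hdom hi)
        ⟨t, (hnth hi).trans_le ht⟩
      primaryHas := by
        rintro p x hp ⟨k, hk, hkp, hno⟩
        refine h.primaryHas p (f x) hp ⟨k, hdom hk, (hnth hk).symm.trans hkp, fun hin' => hno ?_⟩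
        change InLog _ (k, nth (L x) k) p
        rw [hnth hk]
        exact hin hp hin'
      logMatching := by
        rintro x y i ⟨hx, hy⟩ he j hj
        change nth (L x) i = nth (L y) i at he
        change nth (L x) j = nth (L y) j
        rw [hnth hx, hnth hy] at he
        rw [hnth (hlow hx hj.1 hj.2), hnth (hlow hy hj.1 hj.2)]
        exact h.logMatching _ _ i ⟨hdom hx, hdom hy⟩ he j hj
      primaryTerm := fun p hp i hi => by
        simp only [hprim p hp] at hi ⊢
        exact h.primaryTerm p hp i hi
      monotone := fun x i hi j hj hij => by
        change nth (L x) i ≤ nth (L x) j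
        rw [hnth hi, hnth hj]
        exact h.monotone _ i (hdom hi) j (hdom hj) hij
      uniform := by
        rintro x y i hi hfirst ⟨k, hk, hki, hlt⟩
        change nth (L y) k = nth (L x) i at hki
        rw [hnth hk, hnth hi] at hki
        refine h.uniform (f x) (f y) i (hdom hi) (fun j hj hji => ?_) ⟨k, hdom hk, hki, hlt⟩
        have hj' := hlow hi hj.1 hji.le
        rw [← hnth hi, ← hnth hj']
        exact hfirst j hj' hji
      leaderComplete := fun p c hc hp hlt => hin hp (h.leaderComplete p c hc hp hlt)
      logsLater := by
        rintro x c hc ⟨i, hi, hlt⟩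
        change c.term < nth (L x) i at hlt
        obtain ⟨h₁, h₂⟩ := h.inLog_of_later hc (hdom hi) (hnth hi ▸ hlt)
        have hd := hlow hi (h.one_le_index hc) h₂.le
        exact ⟨hd.2, (hnth hd).trans (h₁.2.trans (h.termMatches c hc).symm)⟩
      activeCommitted := hcom }

theorem getEntries (h : Inv σ) {σ' : State Server} {s t : Server} (ha : GetEntries σ σ' s t) :
    Inv σ' := by
  obtain ⟨hs, hlen, hag, rfl⟩ := ha
  have hpre : σ.log s ++ [nth (σ.log t) (Len (σ.log s) + 1)] <+: σ.log t := by
    refine append_nth_prefix hlen fun i hi => ?_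
    have hi' := mem_Dom.1 hi
    have hne : σ.log s ≠ [] := Len_pos_iff.1 (by omega)
    exact h.logMatching s t (Len (σ.log s)) ⟨⟨by omega, le_rfl⟩, ⟨by omega, hlen.le⟩⟩
      (hag.resolve_left hne).symm i hi'
  refine h.of_prefix (fun x => ?_) (fun x hx => ?_) fun c hc x hx Q hQ => ?_
  · by_cases hxs : x = s
    · subst hxs
      exact ⟨t, by rwa [Function.update_self]⟩
    · exact ⟨x, by rw [Function.update_of_ne hxs]⟩
  · refine Function.update_of_ne ?_ _ _
    rintro rfl
    simp [hs] at hx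
  · obtain ⟨n, hn, hin⟩ := h.activeCommitted c hc x hx Q hQ
    refine ⟨n, hn, ?_⟩
    by_cases hns : n = s
    · subst hns
      have hp := List.prefix_append (σ.log n) [nth (σ.log t) (Len (σ.log n) + 1)]
      simp only [InLog, Function.update_self]
      exact ⟨mem_Dom_of_prefix hp hin.1, (nth_of_prefix hp hin.1).trans hin.2⟩
    · simpa only [InLog, Function.update_of_ne hns] using hin

/-- The entry removed is not committed, as the log of `t`, which ends in a later term, would have
it. -/
theorem rollbackEntries (h : Inv σ) {σ' : State Server} {s t : Server}
    (ha : RollbackEntries σ σ' s t) : Inv σ' := by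
  obtain ⟨hs, ⟨hpos, hlt, hdiff⟩, rfl⟩ := ha
  have hlast := LastTerm_of_pos hpos
  have hsd : Len (σ.log s) ∈ Dom (σ.log s) := ⟨by omega, le_rfl⟩
  have htpos : 0 < Len (σ.log t) := by
    refine Len_pos_iff.2 fun hnil => ?_
    have h₀ : LastTerm (σ.log t) = 0 := if_pos hnil
    have := h.typeOK.1 s _ (nth_mem hsd)
    omega
  have htlast := LastTerm_of_pos htpos
  refine h.of_prefix (fun x => ⟨x, ?_⟩) (fun x hx => ?_) fun c hc x hx Q hQ => ?_
  · by_cases hxs : x = s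
    · subst hxs
      rw [Function.update_self]
      exact List.dropLast_prefix _
    · rw [Function.update_of_ne hxs]
  · refine Function.update_of_ne ?_ _ _
    rintro rfl
    simp [hs] at hx
  · obtain ⟨n, hn, hin⟩ := h.activeCommitted c hc x hx Q hQ
    refine ⟨n, hn, ?_⟩
    by_cases hns : n = s
    · subst hns
      have hct := h.termMatches c hc
      have hi := mem_Dom.1 hin.1
      have hne : c.entry.1 ≠ Len (σ.log n) := by
        intro he
        have hv := hin.2
        rw [he] at hv
        obtain ⟨h₁, -⟩ := h.inLog_of_later hc (s := t) (i := Len (σ.log t))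
          ⟨by omega, le_rfl⟩ (by omega)
        have h₂ := h₁.1.2
        have h₃ := h₁.2
        rw [he] at h₂ h₃
        omega
      have hd : c.entry.1 ∈ Dom (σ.log n).dropLast := by
        rw [mem_Dom]
        simp only [Len, List.length_dropLast] at hi hne ⊢
        omega
      simp only [InLog, Function.update_self]
      exact ⟨hd, (nth_of_prefix (List.dropLast_prefix _) hd).symm.trans hin.2⟩
    · simpa only [InLog, Function.update_of_ne hns] using hin

/-! ### Commitment -/

omit [DecidableEq Server] in
/-- A quorum in the term of the primary shows that no configuration, hence no log entry and no
primary, has a later term, and that the configuration of the primary is active. -/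
theorem commitEntry (h : Inv σ) {σ' : State Server} {s : Server} {Q : Finset Server}
    (hQ : Q ∈ Quorums (σ.config s)) (ha : CommitEntry σ σ' s Q) : Inv σ' := by
  obtain ⟨hpos, hs, hlast, himm, -, rfl⟩ := ha
  have hle := h.configTerm_le_of_quorum hs hQ fun n hn => (himm n hn).2
  have hact : s ∈ ActiveConfigSet σ := mem_activeConfigSet.2 ⟨Q, hQ, fun n _ hnew => by
    have h₁ := h.term_lt_of_newer hs hnew
    have h₂ := hle n
    omega⟩
  exact
    { h with
      typeOK := by
        refine ⟨h.typeOK.1, ?_, h.typeOK.2.2⟩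
        rintro c (hc | rfl)
        · exact h.typeOK.2.1 c hc
        · exact ⟨hpos.le, h.typeOK.2.2.1 s, h.typeOK.2.2.1 s⟩
      indexNonZero := by
        rintro c (hc | rfl)
        · exact h.indexNonZero c hc
        · exact hpos.ne'
      termMatches := by
        rintro c (hc | rfl)
        · exact h.termMatches c hc
        · rfl
      leaderComplete := by
        rintro p c (hc | rfl) hp hlt
        · exact h.leaderComplete p c hc hp hlt
        · have h₁ := h.primaryConfigTerm p hp
          have h₂ := hle p
          change σ.currentTerm s < σ.currentTerm p at hlt
          omega
      logsLater := by
        rintro x c (hc | rfl) hlt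
        · exact h.logsLater x c hc hlt
        · obtain ⟨i, hi, hlt⟩ := hlt
          obtain ⟨t, ht⟩ := h.entryConfig x i hi
          have := hle t
          change σ.currentTerm s < nth (σ.log x) i at hlt
          omega
      activeCommitted := by
        rintro c (hc | rfl) x hx Q' hQ'
        · exact h.activeCommitted c hc x hx Q' hQ'
        · obtain ⟨n, hn, hn'⟩ := h.activeOverlap x hx s hact Q' hQ' Q hQ
          exact ⟨n, hn, (himm n hn').1⟩ }

/-! ### Actions that change configurations -/

theorem sendConfig (h : Inv σ) {σ' : State Server} {s t : Server} (ha : SendConfig σ σ' s t) :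
    Inv σ' := by
  obtain ⟨ht, hnew, rfl⟩ := ha
  set σ' : State Server := { σ with
    config := Function.update σ.config t (σ.config s)
    configVersion := Function.update σ.configVersion t (σ.configVersion s)
    configTerm := Function.update σ.configTerm t (σ.configTerm s) } with hσ'
  -- Every configuration of the new state is one of the old state.
  have hfrom : ∀ x, ∃ y, σ'.config x = σ.config y ∧ σ'.configVersion x = σ.configVersion y ∧
      σ'.configTerm x = σ.configTerm y ∧ (x ∈ ActiveConfigSet σ' → y ∈ ActiveConfigSet σ) ∧
      (σ.state x = Role.Primary → y = x) := by
    intro x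
    by_cases hx : x = t
    · subst hx
      refine ⟨s, by simp [hσ'], by simp [hσ'], by simp [hσ'],
        active_of_active (by simp [hσ']) fun n hn => ?_, by simp [ht]⟩
      simp only [hσ', IsNewerConfig, Function.update_apply] at hn hnew ⊢
      by_cases hnx : n = x
      · subst hnx; omega
      · simpa [hnx] using hn
    · refine ⟨x, by simp [hσ', hx], by simp [hσ', hx], by simp [hσ', hx],
        active_of_active (by simp [hσ', hx]) fun n hn => ?_, fun _ => rfl⟩
      simp only [hσ', IsNewerConfig, Function.update_apply, if_neg hx] at hn hnew ⊢
      split_ifs with hnx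
      · subst hnx; omega
      · exact hn
  choose g hgc hgv hgt hga hgp using hfrom
  have hmono : ∀ x, σ.configTerm x ≤ σ'.configTerm x := by
    intro x
    simp only [hσ', Function.update_apply]
    simp only [IsNewerConfig] at hnew
    split_ifs with hx
    · subst hx; omega
    · rfl
  exact
    { h with
      typeOK := ⟨h.typeOK.1, h.typeOK.2.1, h.typeOK.2.2.1, h.typeOK.2.2.2.1,
        fun x => hgv x ▸ h.typeOK.2.2.2.2.1 (g x), fun x => hgt x ▸ h.typeOK.2.2.2.2.2 (g x)⟩
      primaryConfigTerm := fun p hp => by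
        rw [hgt, hgp p hp]
        exact h.primaryConfigTerm p hp
      configUnique := fun x y h₁ h₂ => by
        rw [hgt, hgt] at h₁
        rw [hgv, hgv] at h₂
        rw [hgc, hgc]
        exact h.configUnique _ _ h₁ h₂
      primaryNewest := fun p x hp hx => by
        rw [hgt] at hx
        rw [hgv, hgv, hgp p hp]
        exact h.primaryNewest p (g x) hp hx
      activeOverlap := fun x hx y hy => by
        rw [hgc, hgc]
        exact h.activeOverlap _ (hga x hx) _ (hga y hy)
      activeSafe := fun x y hy => by
        rw [hgc, hgt]
        exact h.activeSafe _ _ (hga y hy)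
      entryConfig := fun x i hi =>
        let ⟨y, hy⟩ := h.entryConfig x i hi
        ⟨y, hy.trans (hmono y)⟩
      activeCommitted := fun c hc x hx => by
        rw [hgc]
        exact h.activeCommitted c hc _ (hga x hx)
      newerDisable := fun x p hp hx => by
        rw [hgt] at hx
        rw [hgc, hgp p hp]
        exact h.newerDisable (g x) p hp hx
      nonEmpty := fun x => hgc x ▸ h.nonEmpty (g x) }

/-- The term check makes the old configuration of `s` the newest of all, and by the configuration
check any other configuration active afterwards is a copy of it; hence it suffices that the new
configuration overlaps the old one. -/
theorem reconfig (h : Inv σ) {σ' : State Server} {s : Server} {m : Finset Server}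
    (ha : Reconfig σ σ' s m) : Inv σ' := by
  obtain ⟨hs, ⟨Qc, hQc, hQc'⟩, ⟨Qt, hQt, hQt'⟩, ⟨hop₁, hop₂⟩, hov, hsm, rfl⟩ := ha
  -- The term of the configuration of `s` does not change.
  have hct : Function.update σ.configTerm s (σ.currentTerm s) = σ.configTerm := by
    rw [← h.primaryConfigTerm s hs, Function.update_eq_self]
  rw [hct]
  set σ' : State Server := { σ with
    config := Function.update σ.config s m
    configVersion := Function.update σ.configVersion s (σ.configVersion s + 1) } with hσ'
  have hle := h.configTerm_le_of_quorum hs hQt hQt'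
  have hmax : ∀ x, ¬ IsNewerConfig σ x s := fun x hx => by
    have h₁ := h.term_lt_of_newer hs hx
    have h₂ := hle x
    omega
  have hacts : s ∈ ActiveConfigSet σ := mem_activeConfigSet.2 ⟨Qt, hQt, fun n _ => hmax n⟩
  have hcs : σ'.config s = m := by simp [hσ']
  have hvs : σ'.configVersion s = σ.configVersion s + 1 := by simp [hσ']
  have hc : ∀ {x}, x ≠ s → σ'.config x = σ.config x := fun hx => by simp [hσ', hx]
  have hv : ∀ {x}, x ≠ s → σ'.configVersion x = σ.configVersion x := fun hx => by simp [hσ', hx]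
  have hvle : ∀ x, σ.configVersion x ≤ σ'.configVersion x := fun x => by
    by_cases hx : x = s
    · subst hx; omega
    · exact (hv hx).ge
  have hnewer : ∀ {x n}, x ≠ s → IsNewerConfig σ n x → IsNewerConfig σ' n x := by
    intro x n hx hn
    have := hvle n
    simp only [IsNewerConfig, hv hx] at hn ⊢
    change σ.configTerm x < σ.configTerm n ∨ (σ.configTerm n = σ.configTerm x ∧ _)
    omega
  have hact : ∀ {x}, x ≠ s → x ∈ ActiveConfigSet σ' → x ∈ ActiveConfigSet σ :=
    fun hx => active_of_active (hc hx) fun n hn => hnewer hx hn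
  -- Quorums of active configurations other than copies of that of `s` meet `Qc`, where they find
  -- a newer configuration.
  have hovx : ∀ {x}, x ≠ s → x ∈ ActiveConfigSet σ' → QuorumsOverlap m (σ.config x) := by
    intro x hx hxa
    by_cases hsame : σ.configTerm x = σ.configTerm s ∧ σ.configVersion x = σ.configVersion s
    · rw [h.configUnique x s hsame.1 hsame.2]
      exact hov.symm
    · obtain ⟨Q, hQ, hQn⟩ := mem_activeConfigSet.1 hxa
      rw [hc hx] at hQ
      obtain ⟨n, hn, hn'⟩ := h.activeOverlap x (hact hx hxa) s hacts Q hQ Qc hQc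
      refine absurd (hnewer hx ?_) (hQn n hn)
      have h₁ := hQc' n hn'
      have h₂ := hmax x
      simp only [IsNewerConfig] at h₂ ⊢
      omega
  have hnews : ∀ {x}, x ≠ s → σ.configTerm x = σ.configTerm s →
      σ.configVersion x ≤ σ.configVersion s := fun _ hx =>
    h.primaryNewest s _ hs (hx.trans (h.primaryConfigTerm s hs))
  -- A committed entry is on a quorum of the old configuration of `s`.
  have hcomm : ∀ c ∈ σ.committed, ∃ Q ∈ Quorums (σ.config s), ∀ n ∈ Q, InLog σ c.entry n := by
    intro c hcc
    rcases lt_trichotomy c.term (σ.currentTerm s) with hlt | heq | hgt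
    · rcases hop₁ with hempty | ⟨c', hc', hc't⟩
      · simp [hempty] at hcc
      · obtain ⟨Q, hQ, himm⟩ := hop₂ c' hc' hc't
        refine ⟨Q, hQ, fun n hn => ?_⟩
        obtain ⟨⟨hd, hval⟩, -⟩ := himm n hn
        have := h.termMatches c' hc'
        exact (h.inLog_of_later hcc hd (by omega)).1
    · obtain ⟨Q, hQ, himm⟩ := hop₂ c hcc heq
      exact ⟨Q, hQ, fun n hn => (himm n hn).1⟩
    · obtain ⟨n, -, hin⟩ := h.activeCommitted c hcc s hacts Qt hQt
      obtain ⟨t, ht⟩ := h.exists_configTerm_ge hin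
      have h₁ := hle t
      have h₂ := h.termMatches c hcc
      omega
  exact
    { h with
      typeOK := ⟨h.typeOK.1, h.typeOK.2.1, h.typeOK.2.2.1, h.typeOK.2.2.2.1,
        fun x => (h.typeOK.2.2.2.2.1 x).trans (hvle x), h.typeOK.2.2.2.2.2⟩
      configUnique := fun x y h₁ h₂ => by
        change σ.configTerm x = σ.configTerm y at h₁
        by_cases hx : x = s <;> by_cases hy : y = s
        · rw [hx, hy]
        · subst hx
          rw [hvs, hv hy] at h₂
          have := hnews hy h₁.symm
          omega
        · subst hy
          rw [hvs, hv hx] at h₂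
          have := hnews hx h₁
          omega
        · rw [hv hx, hv hy] at h₂
          rw [hc hx, hc hy]
          exact h.configUnique x y h₁ h₂
      primaryNewest := fun p x hp hx => by
        by_cases hxs : x = s
        · subst hxs
          have : x = p := h.electionSafety x p hs hp ((h.primaryConfigTerm x hs).symm.trans hx)
          rw [this]
        · rw [hv hxs]
          exact (h.primaryNewest p x hp hx).trans (hvle p)
      activeOverlap := fun x hx y hy => by
        by_cases hxs : x = s <;> by_cases hys : y = s
        · rw [hxs, hys]
          exact quorumsOverlap_self _
        · rw [hxs, hcs, hc hys]
          exact hovx hys hy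
        · rw [hys, hcs, hc hxs]
          exact (hovx hxs hx).symm
        · rw [hc hxs, hc hys]
          exact h.activeOverlap x (hact hxs hx) y (hact hys hy)
      activeSafe := fun x y hy Q hQ => by
        by_cases hys : y = s
        · rw [hys, hcs] at hQ
          obtain ⟨n, hn, hn'⟩ := hov Qt hQt Q hQ
          exact ⟨n, hn', (hle x).trans (hQt' n hn).ge⟩
        · rw [hc hys] at hQ
          exact h.activeSafe x y (hact hys hy) Q hQ
      activeCommitted := fun c hcc x hx Q hQ => by
        by_cases hxs : x = s
        · rw [hxs, hcs] at hQ
          obtain ⟨Q', hQ', hin⟩ := hcomm c hcc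
          obtain ⟨n, hn, hn'⟩ := hov Q' hQ' Q hQ
          exact ⟨n, hn', hin n hn⟩
        · rw [hc hxs] at hQ
          exact h.activeCommitted c hcc x (hact hxs hx) Q hQ
      newerDisable := fun x p hp hx Q hQ => by
        by_cases hps : p = s
        · subst hps
          exact absurd hx (hle x).not_gt
        · rw [hc hps] at hQ
          exact h.newerDisable x p hp hx Q hQ
      nonEmpty := fun x => by
        by_cases hxs : x = s
        · rw [hxs, hcs]
          exact Finset.ne_empty_of_mem hsm
        · rw [hc hxs]
          exact h.nonEmpty x }

/-! ### Actions that change terms -/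

/-- The voters show that the configuration of `s` is active, so that by `ActiveConfigsSafeAtTerms`
the new term is later than those of all configurations, and hence of all log entries and of all
primaries. Every quorum of an active configuration contains a voter. -/
theorem becomeLeader (h : Inv σ) {σ' : State Server} {s : Server} {Q : Finset Server}
    (hQ : Q ∈ Quorums (σ.config s)) (ha : BecomeLeader σ σ' s Q) : Inv σ' := by
  obtain ⟨-, hsQ, hvote, rfl⟩ := ha
  set T := σ.currentTerm s + 1 with hT
  set σ' : State Server := { σ with
    currentTerm := fun n => if n ∈ Q then T else σ.currentTerm n
    state := fun n =>
      if n = s then Role.Primary else if n ∈ Q then Role.Secondary else σ.state n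
    configTerm := Function.update σ.configTerm s T } with hσ'
  have hacts : s ∈ ActiveConfigSet σ := mem_activeConfigSet.2 ⟨Q, hQ, fun n hn hnew => by
    have := (hvote n hn).2.2
    simp only [IsNewerOrEqualConfig, IsNewerConfig] at this hnew
    omega⟩
  have hct : ∀ x, σ.configTerm x < T := fun x => by
    obtain ⟨n, hn, hle⟩ := h.activeSafe x s hacts Q hQ
    exact hle.trans_lt (hvote n hn).1.1
  have hentry : ∀ x, ∀ i ∈ Dom (σ.log x), nth (σ.log x) i < T := fun x i hi =>
    let ⟨t, ht⟩ := h.entryConfig x i hi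
    ht.trans_lt (hct t)
  have htQ : ∀ {x}, x ∈ Q → σ'.currentTerm x = T := fun hx => by simp [hσ', hx]
  have htn : ∀ {x}, x ∉ Q → σ'.currentTerm x = σ.currentTerm x := fun hx => by simp [hσ', hx]
  have hts : σ'.currentTerm s = T := htQ hsQ
  have htle : ∀ x, σ.currentTerm x ≤ σ'.currentTerm x := fun x => by
    by_cases hx : x ∈ Q
    · rw [htQ hx]
      exact (hvote x hx).1.1.le
    · exact (htn hx).ge
  have hcs : σ'.configTerm s = T := by simp [hσ']
  have hcn : ∀ {x}, x ≠ s → σ'.configTerm x = σ.configTerm x := fun hx => by simp [hσ', hx]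
  have hcle : ∀ x, σ.configTerm x ≤ σ'.configTerm x := fun x => by
    by_cases hx : x = s
    · rw [hx, hcs]
      exact (hct s).le
    · exact (hcn hx).ge
  have hcT : ∀ x, σ'.configTerm x ≤ T := fun x => by
    by_cases hx : x = s
    · rw [hx, hcs]
    · rw [hcn hx]
      exact (hct x).le
  -- A primary other than `s` is no voter, and its term is older than `T`.
  have hprim : ∀ {p}, p ≠ s → σ'.state p = Role.Primary →
      σ.state p = Role.Primary ∧ σ'.currentTerm p = σ.currentTerm p ∧ σ.currentTerm p < T := by
    intro p hps hp
    have hpQ : p ∉ Q := fun hpQ => by simp [hσ', hps, hpQ] at hp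
    have hp' : σ.state p = Role.Primary := by simpa [hσ', hps, hpQ] using hp
    exact ⟨hp', htn hpQ, h.primaryConfigTerm p hp' ▸ hct p⟩
  have hact : ∀ {x}, x ∈ ActiveConfigSet σ' → x ∈ ActiveConfigSet σ := by
    intro x hx
    by_cases hxs : x = s
    · rwa [hxs]
    · refine active_of_active (σ' := σ') rfl (fun n hn => ?_) hx
      by_cases hns : n = s
      · exact .inl (by rw [hns, hcs, hcn hxs]; exact hct x)
      · simpa only [IsNewerConfig, hcn hxs, hcn hns] using hn
  exact
    { h with
      typeOK := ⟨h.typeOK.1, h.typeOK.2.1, fun x => (h.typeOK.2.2.1 x).trans (htle x),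
        fun x => by cases σ'.state x <;> simp, h.typeOK.2.2.2.2.1,
        fun x => (h.typeOK.2.2.2.2.2 x).trans (hcle x)⟩
      electionSafety := fun x y hx hy he => by
        by_cases hxs : x = s <;> by_cases hys : y = s
        · rw [hxs, hys]
        · obtain ⟨-, h₁, h₂⟩ := hprim hys hy
          rw [hxs, hts] at he
          omega
        · obtain ⟨-, h₁, h₂⟩ := hprim hxs hx
          rw [hys, hts] at he
          omega
        · obtain ⟨hx', h₁, -⟩ := hprim hxs hx
          obtain ⟨hy', h₂, -⟩ := hprim hys hy
          exact h.electionSafety x y hx' hy' (by omega)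
      primaryConfigTerm := fun p hp => by
        by_cases hps : p = s
        · rw [hps, hcs, hts]
        · obtain ⟨hp', h₁, -⟩ := hprim hps hp
          rw [hcn hps, h₁]
          exact h.primaryConfigTerm p hp'
      configUnique := fun x y h₁ h₂ => by
        by_cases hxs : x = s <;> by_cases hys : y = s
        · rw [hxs, hys]
        · rw [hxs, hcs, hcn hys] at h₁
          exact absurd h₁ (hct y).ne'
        · rw [hys, hcs, hcn hxs] at h₁
          exact absurd h₁ (hct x).ne
        · rw [hcn hxs, hcn hys] at h₁
          exact h.configUnique x y h₁ h₂
      primaryNewest := fun p x hp hx => by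
        by_cases hps : p = s <;> by_cases hxs : x = s
        · rw [hps, hxs]
        · rw [hps, hts, hcn hxs] at hx
          exact absurd hx (hct x).ne
        · obtain ⟨-, h₁, h₂⟩ := hprim hps hp
          rw [hxs, hcs] at hx
          omega
        · obtain ⟨hp', h₁, -⟩ := hprim hps hp
          rw [hcn hxs, h₁] at hx
          exact h.primaryNewest p x hp' hx
      activeOverlap := fun x hx y hy => h.activeOverlap x (hact hx) y (hact hy)
      activeSafe := fun x y hy Q' hQ' => by
        obtain ⟨n, hn, hn'⟩ := h.activeOverlap y (hact hy) s hacts Q' hQ' Q hQ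
        exact ⟨n, hn, (hcT x).trans (htQ hn').ge⟩
      entryConfig := fun x i hi =>
        let ⟨t, ht⟩ := h.entryConfig x i hi
        ⟨t, ht.trans (hcle t)⟩
      primaryHas := by
        rintro p x hp ⟨k, hk, hkp, hno⟩
        by_cases hps : p = s
        · rw [hps, hts] at hkp
          exact absurd hkp (hentry x k hk).ne
        · obtain ⟨hp', h₁, -⟩ := hprim hps hp
          exact h.primaryHas p x hp' ⟨k, hk, hkp.trans h₁, hno⟩
      primaryTerm := fun p hp i hi => by
        by_cases hps : p = s
        · rw [hps, hts]
          exact (hentry s i (hps ▸ hi)).le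
        · obtain ⟨hp', h₁, -⟩ := hprim hps hp
          rw [h₁]
          exact h.primaryTerm p hp' i hi
      leaderComplete := fun p c hc hp hlt => by
        by_cases hps : p = s
        · obtain ⟨v, hv, hin⟩ := h.activeCommitted c hc s hacts Q hQ
          rw [hps]
          exact h.inLog_of_upToDate hc hin (hvote v hv).1.2
        · obtain ⟨hp', h₁, -⟩ := hprim hps hp
          exact h.leaderComplete p c hc hp' (h₁ ▸ hlt)
      activeCommitted := fun c hc x hx => h.activeCommitted c hc x (hact hx)
      newerDisable := fun x p hp hx Q' hQ' => by
        by_cases hps : p = s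
        · rw [hps, hts] at hx
          exact absurd hx (hcT x).not_gt
        · obtain ⟨hp', h₁, h₂⟩ := hprim hps hp
          rw [h₁] at hx ⊢
          by_cases hxs : x = s
          · by_cases hpa : p ∈ ActiveConfigSet σ
            · obtain ⟨n, hn, hn'⟩ := h.activeOverlap p hpa s hacts Q' hQ' Q hQ
              exact ⟨n, hn, h₂.trans_eq (htQ hn').symm⟩
            · -- A disabled primary is outdated by a configuration of a later term.
              obtain ⟨n, -, hnew⟩ := not_not.1 hpa Q' hQ'
              obtain ⟨n', hn', hlt⟩ :=
                h.newerDisable n p hp' (h.term_lt_of_newer hp' hnew) Q' hQ'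
              exact ⟨n', hn', hlt.trans_le (htle n')⟩
          · rw [hcn hxs] at hx
            obtain ⟨n, hn, hlt⟩ := h.newerDisable x p hp' hx Q' hQ'
            exact ⟨n, hn, hlt.trans_le (htle n)⟩ }

theorem updateTerms (h : Inv σ) {σ' : State Server} {s t : Server} (ha : UpdateTerms σ σ' s t) :
    Inv σ' := by
  obtain ⟨hlt, rfl⟩ := ha
  set σ' : State Server := { σ with
    currentTerm := Function.update σ.currentTerm t (σ.currentTerm s)
    state := Function.update σ.state t Role.Secondary } with hσ'
  have htle : ∀ x, σ.currentTerm x ≤ σ'.currentTerm x := fun x => by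
    by_cases hx : x = t
    · subst hx; simpa [hσ'] using hlt.le
    · simp [hσ', hx]
  have hprim : ∀ {p}, σ'.state p = Role.Primary →
      σ.state p = Role.Primary ∧ σ'.currentTerm p = σ.currentTerm p := by
    intro p hp
    have hpt : p ≠ t := by
      rintro rfl
      simp [hσ'] at hp
    exact ⟨by simpa [hσ', hpt] using hp, by simp [hσ', hpt]⟩
  exact
    { h with
      typeOK := ⟨h.typeOK.1, h.typeOK.2.1, fun x => (h.typeOK.2.2.1 x).trans (htle x),
        fun x => by cases σ'.state x <;> simp, h.typeOK.2.2.2.2⟩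
      electionSafety := fun x y hx hy he =>
        h.electionSafety x y (hprim hx).1 (hprim hy).1 ((hprim hx).2 ▸ (hprim hy).2 ▸ he)
      primaryConfigTerm := fun p hp =>
        (h.primaryConfigTerm p (hprim hp).1).trans (hprim hp).2.symm
      primaryNewest := fun p x hp hx =>
        h.primaryNewest p x (hprim hp).1 (hx.trans (hprim hp).2)
      activeSafe := fun x y hy Q hQ =>
        let ⟨n, hn, hle⟩ := h.activeSafe x y hy Q hQ
        ⟨n, hn, hle.trans (htle n)⟩
      primaryHas := fun p x hp ⟨k, hk, hkp, hno⟩ =>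
        h.primaryHas p x (hprim hp).1 ⟨k, hk, hkp.trans (hprim hp).2, hno⟩
      primaryTerm := fun p hp i hi =>
        (h.primaryTerm p (hprim hp).1 i hi).trans (htle p)
      leaderComplete := fun p c hc hp hlt =>
        h.leaderComplete p c hc (hprim hp).1 (hlt.trans_eq (hprim hp).2)
      newerDisable := fun x p hp hx Q hQ => by
        rw [(hprim hp).2] at hx ⊢
        obtain ⟨n, hn, hgt⟩ := h.newerDisable x p (hprim hp).1 hx Q hQ
        exact ⟨n, hn, hgt.trans_le (htle n)⟩ }

/-! ### Initiation and consecution -/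

/-- The only overlap needed initially is that of the majorities of one set. -/
theorem of_init {σ : State Server} (h : MRRInit σ) : Inv σ := by
  obtain ⟨hlog, hcom, hterm, hstate, ⟨m, hm, hconf⟩, hver, hct⟩ := h
  have hdom : ∀ {s i}, i ∉ Dom (σ.log s) := by
    intro s i hi
    simp only [hlog, mem_Dom, Len, List.length_nil] at hi
    omega
  have hnc : ∀ {c}, c ∉ σ.committed := by simp [hcom]
  have hnp : ∀ {s}, σ.state s ≠ Role.Primary := by simp [hstate]
  exact
    { typeOK := by simp [TypeOK, hlog, hcom, hterm, hstate, hver, hct]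
      electionSafety := fun _ _ hs => absurd hs hnp
      primaryConfigTerm := fun _ hs => absurd hs hnp
      configUnique := fun _ _ _ _ => by rw [hconf]
      primaryNewest := fun _ _ hs => absurd hs hnp
      activeOverlap := fun _ _ _ _ => by rw [hconf]; exact quorumsOverlap_self m
      activeSafe := fun _ _ _ _ hQ =>
        let ⟨n, hn⟩ := quorum_nonempty hQ
        ⟨n, hn, by simp [hct, hterm]⟩
      entryConfig := fun _ _ hi => absurd hi hdom
      primaryHas := fun _ _ hs => absurd hs hnp
      logMatching := fun _ _ _ hi => absurd hi.1 hdom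
      primaryTerm := fun _ hs => absurd hs hnp
      monotone := fun _ _ hi => absurd hi hdom
      uniform := fun _ _ _ hi => absurd hi hdom
      indexNonZero := fun _ hc => absurd hc hnc
      termMatches := fun _ hc => absurd hc hnc
      leaderComplete := fun _ _ hc => absurd hc hnc
      logsLater := fun _ _ hc => absurd hc hnc
      activeCommitted := fun _ hc => absurd hc hnc
      newerDisable := fun _ _ hs => absurd hs hnp
      nonEmpty := fun _ => by rw [hconf]; exact hm.ne_empty }

theorem next (h : Inv σ) {σ' : State Server} (hn : MRRNext σ σ') : Inv σ' := by
  obtain ⟨s, t, Q, hQ, ha | ha | ha | ha | ha | ⟨m, ha⟩ | ha | ha⟩ := hn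
  · exact h.clientRequest ha
  · exact h.getEntries ha
  · exact h.rollbackEntries ha
  · exact h.commitEntry hQ ha
  · exact h.sendConfig ha
  · exact h.reconfig ha
  · exact h.becomeLeader hQ ha
  · exact h.updateTerms ha

end Inv

end MongoRaftReconfig

theorem mainTheorem1 {Server : Type*} [Fintype Server] [DecidableEq Server] :
    (∀ σ : MongoRaftReconfig.State Server,
      MongoRaftReconfig.MRRInit σ → MongoRaftReconfig.MRRInd σ) ∧
    (∀ σ σ' : MongoRaftReconfig.State Server,
      MongoRaftReconfig.MRRInd σ → MongoRaftReconfig.MRRNext σ σ' →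
        MongoRaftReconfig.MRRInd σ') :=
  ⟨fun _ h => MongoRaftReconfig.mrrInd_iff_inv.2 (.of_init h), fun _ _ h hn =>
    MongoRaftReconfig.mrrInd_iff_inv.2 ((MongoRaftReconfig.mrrInd_iff_inv.1 h).next hn)⟩
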